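/- Let $\mathfrak{S}_n$ be the set of permutations $\pi=\pi_1\pi_2\cdots\pi_n$ of $[n]=\{1,\dots,n\}$. A permutation $\pi\in\mathfrak{S}_n$ contains a pattern $\sigma\in\mathfrak{S}_k$ if there are indices $i_1<\cdots<i_k$ such that $\pi_{i_1}\cdots\pi_{i_k}$ is order isomorphic to $\sigma$, and avoids $\sigma$ otherwise; for a set $\Pi$ of patterns, $\mathfrak{S}_n(\Pi)$ is the set of $\pi\in\mathfrak{S}_n$ that avoid all patterns in $\Pi$. Let $\mathrm{DES}(\pi)=\{i\in[n-1]:\pi_i>\pi_{i+1}\}$ and $\mathrm{des}(\pi)=|\mathrm{DES}(\pi)|$. Write $\Pi\sim_{\mathrm{des}}\Pi'$ if $$\sum_{\sigma\in\mathfrak{S}_n(\Pi)}t^{\mathrm{des}(\sigma)}=\sum_{\sigma\in\mathfrak{S}_n(\Pi')}t^{\mathrm{des}(\sigma)}\quad\text{for all } n,$$ and $\Pi\sim_{\mathrm{DES}}\Pi'$ if $$\sum_{\sigma\in\mathfrak{S}_n(\Pi)}\ \prod_{i\in\mathrm{DES}(\sigma)}t_i=\sum_{\sigma\in\mathfrak{S}_n(\Pi')}\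 \prod_{i\in\mathrm{DES}(\sigma)}t_i\quad\text{for all } n,$$ where $t,t_1,t_2,\dots$ are indeterminates. **Theorem 5.** The following refined Wilf equivalences hold: $$(2413,3142)\sim_{\mathrm{des}}(2413,4213)\sim_{\mathrm{DES}}(2314,3214)\sim_{\mathrm{DES}}(3412,4312).$$ -/

import Mathlib

namespace PatternWilf

/-- The word `w` contains the pattern `p`: there are positions `f 0 < f 1 < ⋯` of `w` whose
letters form a subword that is order isomorphic to `p`. Here `w` is a word of length `n` on the
natural numbers and `p` is a finite word on the natural numbers. -/
def Contains {n : ℕ} (w : Fin n → ℕ) (p : List ℕ) : Prop :=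
  ∃ f : Fin p.length → Fin n, StrictMono f ∧
    ∀ a b : Fin p.length, w (f a) < w (f b) ↔ p.get a < p.get b

/-- The word `w` avoids the pattern `p`. -/
def Avoids {n : ℕ} (w : Fin n → ℕ) (p : List ℕ) : Prop := ¬ Contains w p

/-- One-line notation `π₁ π₂ ⋯ πₙ`, a word with letters in `{1, …, n}`. -/
def word {n : ℕ} (π : Equiv.Perm (Fin n)) : Fin n → ℕ := fun i => (π i : ℕ) + 1

open Classical in
/-- `𝔖ₙ(Π)`: the permutations of length `n` that avoid every pattern in `Π`. -/
noncomputable def avoiders (n : ℕ) (Pats : Set (List ℕ)) : Finset (Equiv.Perm (Fin n)) :=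
  Finset.univ.filter fun π => ∀ p ∈ Pats, Avoids (word π) p

/-- The descent set `{i ∈ [n - 1] : πᵢ > πᵢ₊₁}`, with positions counted from `1`: the zero-based
indices `a` and `b` below are the positions `i` and `i + 1`. -/
def DES {n : ℕ} (π : Equiv.Perm (Fin n)) : Finset ℕ :=
  (Finset.Icc 1 (n - 1)).filter fun i =>
    ∃ a b : Fin n, (a : ℕ) + 1 = i ∧ (b : ℕ) = i ∧ word π b < word π a

/-- The number of descents. -/
def des {n : ℕ} (π : Equiv.Perm (Fin n)) : ℕ := (DES π).card

/-- `∑ t ^ des σ` over the `σ` in `𝔖ₙ(Π)`, a polynomial in one variable. -/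
noncomputable def desPoly (n : ℕ) (Pats : Set (List ℕ)) : Polynomial ℤ :=
  ∑ σ ∈ avoiders n Pats, Polynomial.X ^ des σ

/-- `∑ ∏ tᵢ` over the `σ` in `𝔖ₙ(Π)`, the product being over `i ∈ DES σ`: a polynomial in the
variables `t₁, t₂, …`. -/
noncomputable def desSetPoly (n : ℕ) (Pats : Set (List ℕ)) : MvPolynomial ℕ ℤ :=
  ∑ σ ∈ avoiders n Pats, ∏ i ∈ DES σ, MvPolynomial.X i

/-- `des`-Wilf equivalence of two sets of patterns. -/
def DesNumberEquiv (Pats Pats' : Set (List ℕ)) : Prop :=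
  ∀ n : ℕ, desPoly n Pats = desPoly n Pats'

/-- `DES`-Wilf equivalence of two sets of patterns. -/
def DesSetEquiv (Pats Pats' : Set (List ℕ)) : Prop :=
  ∀ n : ℕ, desSetPoly n Pats = desSetPoly n Pats'

end PatternWilf

/-!
The three `DES`-classes share one generating tree; its `des` series is compared with that of the
separable permutations through an algebraic equation.

*Descent sets.* Each of the pattern pairs `{2413, 4213}`, `{2314, 3214}`, `{3412, 4312}` forbids
two earlier letters, in either order, followed by a letter `x` and a later letter `y > x`, the two
earlier letters being placed relative to `x` and `y` in a prescribed way (`mem_avoiders_straddle`,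
`mem_avoiders_between`, `mem_avoiders_above`). Such permutations are grown from the left by
appending a last letter, which never changes the earlier descents. Appending a letter at the `i`-th
lowest of `k` active sites leaves the sites below it as they were, and exactly two active sites
above it if `i < k`, exactly one if `i = k` (`TwoOrOneAbove`, proved separately for the three
relations). So the three generating trees are isomorphic, with the same descents along
corresponding edges, and the descent set polynomials agree (`sum_avoidsRel_eq_treeWeight`).

*Descent numbers of separable permutations.* A permutation of length at least two that avoids
`2413` and `3142` is either a direct sum or a skew sum (`exists_isCut_of_separable`), not both.
Splitting off the first block of a direct sum gives `S = I + I S` for the series `S` of all and `I`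
of the sum indecomposable ones, complementing gives `S = J + t J S` for the skew indecomposable
ones, and `I + J = S + x`; hence `S - t S³ = x (1 + S) (1 + t S)` (`sepSeries_cubic`).

*Comparison.* When all descents weigh `t`, the generating tree is an infinite linear system of
power series with a unique solution (`coeff_eq_treeCount`). The solution is geometric in the number
of active sites below the last letter, and its ratio can be written rationally in `S`; the cubic
equation is what is needed to check this, and the series at the root is `1 + S`
(`coeff_one_add_sepSeries`).
-/

namespace PatternWilf

/-! ### Pattern containment in words -/

theorem contains_four_iff {n : ℕ} (w : Fin n → ℕ) (p q r s : ℕ) :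
    Contains w [p, q, r, s] ↔ ∃ a b c d : Fin n, a < b ∧ b < c ∧ c < d ∧
      ((w a < w b ↔ p < q) ∧ (w b < w a ↔ q < p)) ∧ ((w a < w c ↔ p < r) ∧ (w c < w a ↔ r < p)) ∧
      ((w a < w d ↔ p < s) ∧ (w d < w a ↔ s < p)) ∧ ((w b < w c ↔ q < r) ∧ (w c < w b ↔ r < q)) ∧
      ((w b < w d ↔ q < s) ∧ (w d < w b ↔ s < q)) ∧
      ((w c < w d ↔ r < s) ∧ (w d < w c ↔ s < r)) := by
  constructor
  · rintro ⟨f, hf, h⟩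
    exact ⟨f ⟨0, by simp⟩, f ⟨1, by simp⟩, f ⟨2, by simp⟩, f ⟨3, by simp⟩,
      hf (by simp), hf (by simp), hf (by simp),
      ⟨h _ _, h _ _⟩, ⟨h _ _, h _ _⟩, ⟨h _ _, h _ _⟩, ⟨h _ _, h _ _⟩, ⟨h _ _, h _ _⟩,
      ⟨h _ _, h _ _⟩⟩
  · rintro ⟨a, b, c, d, hab, hbc, hcd, h1, h2, h3, h4, h5, h6⟩
    refine ⟨(![a, b, c, d] : Fin 4 → Fin n), ?_, ?_⟩
    · change StrictMono (![a, b, c, d] : Fin 4 → Fin n)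
      rw [Fin.strictMono_iff_lt_succ]
      intro i
      fin_cases i
      · exact hab
      · exact hbc
      · exact hcd
    · change ∀ i j : Fin 4, w ((![a, b, c, d] : Fin 4 → Fin n) i) <
        w ((![a, b, c, d] : Fin 4 → Fin n) j) ↔
          [p, q, r, s].get i < [p, q, r, s].get j
      intro i j
      fin_cases i <;> fin_cases j
      · simp
      · exact h1.1
      · exact h2.1
      · exact h3.1
      · exact h1.2
      · simp
      · exact h4.1
      · exact h5.1
      · exact h2.2
      · exact h4.2
      · simp
      · exact h6.1
      · exact h3.2
      · exact h5.2
      · exact h6.2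
      · simp

theorem mem_avoiders_pair {n : ℕ} (σ : Equiv.Perm (Fin n)) (p q : List ℕ) :
    σ ∈ avoiders n {p, q} ↔ ¬ Contains (word σ) p ∧ ¬ Contains (word σ) q := by
  classical
  refine Finset.mem_filter.trans ?_
  simp [Avoids]

/-- No two distinct letters `u` and `v` (in either order), followed by a letter `x` and later a
letter `y`, satisfy `Q u v x y`. Letters are counted from `0`. -/
def AvoidsRel (Q : ℕ → ℕ → ℕ → ℕ → Prop) {n : ℕ} (σ : Equiv.Perm (Fin n)) : Prop :=
  ∀ a b c d : Fin n, a ≠ b → a < c → b < c → c < d → ¬ Q (σ a) (σ b) (σ c) (σ d)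

/-- `u v x y` is order isomorphic to `2413`; with `v` before `u`, to `4213`. -/
def RelStraddle (u v x y : ℕ) : Prop := x < u ∧ u < y ∧ y < v

/-- `x` is the least and `y` the largest of the four letters: `u v x y` is order isomorphic to
`2314` or `3214`. -/
def RelBetween (u v x y : ℕ) : Prop := x < u ∧ u < y ∧ x < v ∧ v < y

/-- `x < y` are the two least of the four letters: `u v x y` is order isomorphic to `3412` or
`4312`. -/
def RelAbove (u v x y : ℕ) : Prop := x < y ∧ y < u ∧ y < v

theorem mem_avoiders_straddle {n : ℕ} (σ : Equiv.Perm (Fin n)) :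
    σ ∈ avoiders n {[2, 4, 1, 3], [4, 2, 1, 3]} ↔ AvoidsRel RelStraddle σ := by
  simp only [mem_avoiders_pair, contains_four_iff, word, AvoidsRel, RelStraddle]
  constructor
  · rintro ⟨h1, h2⟩ a b c d hab hac hbc hcd h
    rcases lt_or_gt_of_ne hab with hlt | hlt
    · exact h1 ⟨a, b, c, d, hlt, hbc, hcd, by omega⟩
    · exact h2 ⟨b, a, c, d, hlt, hac, hcd, by omega⟩
  · intro h
    constructor
    · rintro ⟨a, b, c, d, hab, hbc, hcd, h'⟩
      exact h a b c d hab.ne (hab.trans hbc) hbc hcd (by omega)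
    · rintro ⟨a, b, c, d, hab, hbc, hcd, h'⟩
      exact h b a c d hab.ne' hbc (hab.trans hbc) hcd (by omega)

theorem perm_val_ne {n : ℕ} (σ : Equiv.Perm (Fin n)) {a b : Fin n} (h : a ≠ b) :
    (σ a : ℕ) ≠ σ b := fun h' => h (σ.injective (Fin.ext h'))

theorem mem_avoiders_between {n : ℕ} (σ : Equiv.Perm (Fin n)) :
    σ ∈ avoiders n {[2, 3, 1, 4], [3, 2, 1, 4]} ↔ AvoidsRel RelBetween σ := by
  simp only [mem_avoiders_pair, contains_four_iff, word, AvoidsRel, RelBetween]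
  constructor
  · rintro ⟨h1, h2⟩ a b c d hab hac hbc hcd h
    wlog hlt : a < b generalizing a b
    · exact this b a hab.symm hbc hac (by tauto) (lt_of_le_of_ne (not_lt.1 hlt) hab.symm)
    have hne := perm_val_ne σ hab
    rcases lt_or_gt_of_ne hne with hv | hv
    · exact h1 ⟨a, b, c, d, hlt, hbc, hcd, by omega⟩
    · exact h2 ⟨a, b, c, d, hlt, hbc, hcd, by omega⟩
  · intro h
    constructor <;>
    · rintro ⟨a, b, c, d, hab, hbc, hcd, h'⟩
      exact h a b c d hab.ne (hab.trans hbc) hbc hcd (by omega)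

theorem mem_avoiders_above {n : ℕ} (σ : Equiv.Perm (Fin n)) :
    σ ∈ avoiders n {[3, 4, 1, 2], [4, 3, 1, 2]} ↔ AvoidsRel RelAbove σ := by
  simp only [mem_avoiders_pair, contains_four_iff, word, AvoidsRel, RelAbove]
  constructor
  · rintro ⟨h1, h2⟩ a b c d hab hac hbc hcd h
    wlog hlt : a < b generalizing a b
    · exact this b a hab.symm hbc hac (by tauto) (lt_of_le_of_ne (not_lt.1 hlt) hab.symm)
    have hne := perm_val_ne σ hab
    rcases lt_or_gt_of_ne hne with hv | hv
    · exact h1 ⟨a, b, c, d, hlt, hbc, hcd, by omega⟩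
    · exact h2 ⟨a, b, c, d, hlt, hbc, hcd, by omega⟩
  · intro h
    constructor <;>
    · rintro ⟨a, b, c, d, hab, hbc, hcd, h'⟩
      exact h a b c d hab.ne (hab.trans hbc) hbc hcd (by omega)

/-! ### Appending a last letter -/

/-- The permutation obtained from `σ` by appending a last letter with value `y`, the letters of
`σ` that are at least `y` being raised by one. -/
def snoc {n : ℕ} (σ : Equiv.Perm (Fin n)) (y : Fin (n + 1)) : Equiv.Perm (Fin (n + 1)) :=
  finSuccEquivLast.trans ((Equiv.optionCongr σ).trans (finSuccEquiv' y).symm)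

@[simp]
theorem snoc_last {n : ℕ} (σ : Equiv.Perm (Fin n)) (y : Fin (n + 1)) :
    snoc σ y (Fin.last n) = y := by
  simp [snoc]

theorem snoc_castSucc {n : ℕ} (σ : Equiv.Perm (Fin n)) (y : Fin (n + 1)) (i : Fin n) :
    snoc σ y i.castSucc = y.succAbove (σ i) := by
  simp [snoc]

/-- The order embedding of `ℕ` whose range misses exactly `s`. -/
def lift (s z : ℕ) : ℕ := if z < s then z else z + 1

theorem strictMono_lift (s : ℕ) : StrictMono (lift s) := by
  intro a b h
  unfold lift
  split_ifs <;> omega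

@[simp]
theorem snoc_castSucc_val {n : ℕ} (σ : Equiv.Perm (Fin n)) (y : Fin (n + 1)) (i : Fin n) :
    (snoc σ y i.castSucc : ℕ) = lift y (σ i) := by
  rw [snoc_castSucc, lift, Fin.succAbove]
  simp only [Fin.lt_def, Fin.val_castSucc]
  split_ifs <;> simp

theorem snoc_bijective (n : ℕ) :
    Function.Bijective fun p : Equiv.Perm (Fin n) × Fin (n + 1) => snoc p.1 p.2 := by
  rw [Fintype.bijective_iff_injective_and_card]
  constructor
  · rintro ⟨σ, y⟩ ⟨τ, z⟩ h
    have hy : y = z := by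
      have := congrArg (fun π : Equiv.Perm (Fin (n + 1)) => π (Fin.last n)) h
      simpa using this
    subst hy
    have hσ : σ = τ := by
      ext i
      have := congrArg (fun π : Equiv.Perm (Fin (n + 1)) => (π i.castSucc : ℕ)) h
      simp only [snoc_castSucc_val] at this
      exact (strictMono_lift y).injective this
    rw [hσ]
  · simp [Fintype.card_perm, Nat.factorial_succ, mul_comm]

theorem DES_snoc {n : ℕ} (σ : Equiv.Perm (Fin n)) (y : Fin (n + 1)) [Decidable
      (∃ i : Fin n, (i : ℕ) + 1 = n ∧ (y : ℕ) ≤ σ i)] :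
    DES (snoc σ y) =
      if ∃ i : Fin n, (i : ℕ) + 1 = n ∧ (y : ℕ) ≤ σ i then insert n (DES σ) else DES σ := by
  have key : ∀ j, j ∈ DES (snoc σ y) ↔
      j ∈ DES σ ∨ (j = n ∧ ∃ i : Fin n, (i : ℕ) + 1 = n ∧ (y : ℕ) ≤ σ i) := by
    intro j
    simp only [DES, Finset.mem_filter, Finset.mem_Icc, word, add_lt_add_iff_right]
    constructor
    · rintro ⟨hj, a, b, ha, hb, h⟩
      have han : (a : ℕ) < n := by omega
      obtain ⟨a, rfl⟩ : ∃ a' : Fin n, a = a'.castSucc := ⟨⟨a, han⟩, rfl⟩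
      rw [snoc_castSucc_val] at h
      rcases Fin.eq_castSucc_or_eq_last b with ⟨b, rfl⟩ | rfl
      · left
        rw [snoc_castSucc_val, (strictMono_lift _).lt_iff_lt] at h
        exact ⟨by have := b.2; simp at hb; omega, a, b, by simpa using ha, by simpa using hb, h⟩
      · right
        rw [snoc_last] at h
        simp at hb ha
        refine ⟨hb.symm, a, by omega, ?_⟩
        unfold lift at h
        split_ifs at h <;> omega
    · rintro (⟨hj, a, b, ha, hb, h⟩ | ⟨rfl, i, hi, h⟩)
      · refine ⟨by omega, a.castSucc, b.castSucc, by simpa using ha, by simpa using hb, ?_⟩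
        simpa [(strictMono_lift _).lt_iff_lt] using h
      · refine ⟨by omega, i.castSucc, Fin.last _, by simpa using hi, by simp, ?_⟩
        rw [snoc_last, snoc_castSucc_val, lift]
        split_ifs <;> omega
  ext j
  rw [key]
  split_ifs with h <;> simp [h, or_comm]

theorem notMem_DES_self {n : ℕ} (σ : Equiv.Perm (Fin n)) : n ∉ DES σ := by
  simp only [DES, Finset.mem_filter, Finset.mem_Icc, not_and]
  omega

/-! ### Active sites -/

/-- Site `t` of `σ` is active if appending a letter just above the `t` smallest letters of `σ`
creates no forbidden configuration ending in that letter. On the doubled scale a letter `z` of `σ`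
becomes `2 * z + 1`, and the new letter, lying between `t - 1` and `t`, becomes `2 * t`. -/
def SiteActive (Q : ℕ → ℕ → ℕ → ℕ → Prop) {n : ℕ} (σ : Equiv.Perm (Fin n)) (t : ℕ) : Prop :=
  ∀ a b c : Fin n, a ≠ b → a < c → b < c →
    ¬ Q (2 * σ a + 1) (2 * σ b + 1) (2 * σ c + 1) (2 * t)

/-- `Q u v x y` depends only on the relative order of the four letters, and forces `x < y`. -/
structure IsOrderRel (Q : ℕ → ℕ → ℕ → ℕ → Prop) : Prop where
  map : ∀ φ : ℕ → ℕ, StrictMono φ → ∀ u v x y, Q (φ u) (φ v) (φ x) (φ y) ↔ Q u v x y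
  lt : ∀ u v x y, Q u v x y → x < y

theorem exists_eq_castSucc_of_lt {n : ℕ} {a b : Fin (n + 1)} (h : a < b) :
    ∃ a' : Fin n, a = a'.castSucc :=
  ⟨⟨a, lt_of_lt_of_le h (Nat.lt_succ_iff.1 b.2)⟩, rfl⟩

theorem IsOrderRel.lift_iff_double {Q : ℕ → ℕ → ℕ → ℕ → Prop} (hQ : IsOrderRel Q)
    (u v x t : ℕ) :
    Q (lift t u) (lift t v) (lift t x) t ↔ Q (2 * u + 1) (2 * v + 1) (2 * x + 1) (2 * t) := by
  have hφ : StrictMono fun z =>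
      if z < t then 2 * z + 1 else if z = t then 2 * z else 2 * z - 1 := by
    intro a b h
    dsimp only
    split_ifs <;> omega
  have hz : ∀ z, (if lift t z < t then 2 * lift t z + 1 else if lift t z = t then 2 * lift t z
      else 2 * lift t z - 1) = 2 * z + 1 := by
    intro z
    unfold lift
    split_ifs <;> omega
  have := hQ.map _ hφ (lift t u) (lift t v) (lift t x) t
  simpa only [hz, lt_irrefl, if_false, if_true] using this.symm

theorem avoidsRel_snoc {Q : ℕ → ℕ → ℕ → ℕ → Prop} (hQ : IsOrderRel Q) {n : ℕ}
    (σ : Equiv.Perm (Fin n)) (y : Fin (n + 1)) :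
    AvoidsRel Q (snoc σ y) ↔ AvoidsRel Q σ ∧ SiteActive Q σ y := by
  constructor
  · intro h
    constructor
    · intro a b c d hab hac hbc hcd hq
      refine h a.castSucc b.castSucc c.castSucc d.castSucc (by simpa using hab) hac hbc hcd ?_
      simpa only [snoc_castSucc_val, hQ.map _ (strictMono_lift _)] using hq
    · intro a b c hab hac hbc hq
      refine h a.castSucc b.castSucc c.castSucc (Fin.last n) (by simpa using hab) hac hbc
        (Fin.castSucc_lt_last c) ?_
      simpa only [snoc_castSucc_val, snoc_last, hQ.lift_iff_double] using hq
  · rintro ⟨h1, h2⟩ a b c d hab hac hbc hcd hq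
    obtain ⟨a, rfl⟩ := exists_eq_castSucc_of_lt hac
    obtain ⟨b, rfl⟩ := exists_eq_castSucc_of_lt hbc
    obtain ⟨c, rfl⟩ := exists_eq_castSucc_of_lt hcd
    rcases Fin.eq_castSucc_or_eq_last d with ⟨d, rfl⟩ | rfl
    · simp only [snoc_castSucc_val, hQ.map _ (strictMono_lift _)] at hq
      exact h1 a b c d (by simpa using hab) hac hbc hcd hq
    · simp only [snoc_castSucc_val, snoc_last, hQ.lift_iff_double] at hq
      exact h2 a b c (by simpa using hab) hac hbc hq

theorem siteActive_snoc_of_le {Q : ℕ → ℕ → ℕ → ℕ → Prop} (hQ : IsOrderRel Q) {n : ℕ}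
    (σ : Equiv.Perm (Fin n)) {s : Fin (n + 1)} {t : ℕ} (hts : t ≤ s) :
    SiteActive Q (snoc σ s) t ↔ SiteActive Q σ t := by
  have hφ : StrictMono fun z => if z ≤ 2 * (s : ℕ) then z else z + 2 := by
    intro a b h
    dsimp only
    split_ifs <;> omega
  have hz : ∀ z, (if 2 * z + 1 ≤ 2 * (s : ℕ) then 2 * z + 1 else 2 * z + 1 + 2) =
      2 * lift s z + 1 := by
    intro z
    unfold lift
    split_ifs <;> omega
  have key : ∀ u v x, Q (2 * lift s u + 1) (2 * lift s v + 1) (2 * lift s x + 1) (2 * t) ↔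
      Q (2 * u + 1) (2 * v + 1) (2 * x + 1) (2 * t) := by
    intro u v x
    have := hQ.map _ hφ (2 * u + 1) (2 * v + 1) (2 * x + 1) (2 * t)
    simpa only [hz, if_pos (show 2 * t ≤ 2 * (s : ℕ) by omega)] using this
  constructor
  · intro h a b c hab hac hbc hq
    refine h a.castSucc b.castSucc c.castSucc (by simpa using hab) hac hbc ?_
    simpa only [snoc_castSucc_val, key] using hq
  · intro h a b c hab hac hbc hq
    obtain ⟨a, rfl⟩ := exists_eq_castSucc_of_lt hac
    obtain ⟨b, rfl⟩ := exists_eq_castSucc_of_lt hbc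
    rcases Fin.eq_castSucc_or_eq_last c with ⟨c, rfl⟩ | rfl
    · simp only [snoc_castSucc_val, key] at hq
      exact h a b c (by simpa using hab) hac hbc hq
    · have := hQ.lt _ _ _ _ hq
      rw [snoc_last] at this
      omega

theorem siteActive_snoc_of_gt {Q : ℕ → ℕ → ℕ → ℕ → Prop} (hQ : IsOrderRel Q) {n : ℕ}
    (σ : Equiv.Perm (Fin n)) {s : Fin (n + 1)} {t : ℕ} (hts : s < t) :
    SiteActive Q (snoc σ s) t ↔ SiteActive Q σ (t - 1) ∧
      ∀ a b : Fin n, a ≠ b →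
        ¬ Q (2 * lift s (σ a) + 1) (2 * lift s (σ b) + 1) (2 * s + 1) (2 * t) := by
  have hφ : StrictMono fun z => if z < 2 * (s : ℕ) then z else z + 2 := by
    intro a b h
    dsimp only
    split_ifs <;> omega
  have hz : ∀ z, (if 2 * z + 1 < 2 * (s : ℕ) then 2 * z + 1 else 2 * z + 1 + 2) =
      2 * lift s z + 1 := by
    intro z
    unfold lift
    split_ifs <;> omega
  have ht : (if 2 * (t - 1) < 2 * (s : ℕ) then 2 * (t - 1) else 2 * (t - 1) + 2) = 2 * t := by
    split_ifs <;> omega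
  have key : ∀ u v x, Q (2 * lift s u + 1) (2 * lift s v + 1) (2 * lift s x + 1) (2 * t) ↔
      Q (2 * u + 1) (2 * v + 1) (2 * x + 1) (2 * (t - 1)) := by
    intro u v x
    have := hQ.map _ hφ (2 * u + 1) (2 * v + 1) (2 * x + 1) (2 * (t - 1))
    simpa only [hz, ht] using this
  constructor
  · intro h
    constructor
    · intro a b c hab hac hbc hq
      refine h a.castSucc b.castSucc c.castSucc (by simpa using hab) hac hbc ?_
      simpa only [snoc_castSucc_val, key] using hq
    · intro a b hab hq
      refine h a.castSucc b.castSucc (Fin.last n) (by simpa using hab) (Fin.castSucc_lt_last a)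
        (Fin.castSucc_lt_last b) ?_
      simpa only [snoc_castSucc_val, snoc_last] using hq
  · rintro ⟨h1, h2⟩ a b c hab hac hbc hq
    obtain ⟨a, rfl⟩ := exists_eq_castSucc_of_lt hac
    obtain ⟨b, rfl⟩ := exists_eq_castSucc_of_lt hbc
    rcases Fin.eq_castSucc_or_eq_last c with ⟨c, rfl⟩ | rfl
    · simp only [snoc_castSucc_val, key] at hq
      exact h1 a b c (by simpa using hab) hac hbc hq
    · simp only [snoc_castSucc_val, snoc_last] at hq
      exact h2 a b (by simpa using hab) hq

open Classical in
/-- After a letter is appended at an active site `s`, there are two active sites above it if `σ`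
had an active site above `s`, and one otherwise. -/
def TwoOrOneAbove (Q : ℕ → ℕ → ℕ → ℕ → Prop) : Prop :=
  ∀ (n : ℕ) (σ : Equiv.Perm (Fin n)) (s : Fin (n + 1)), SiteActive Q σ s →
    ((Finset.Ioc (s : ℕ) (n + 1)).filter (SiteActive Q (snoc σ s))).card =
      if ∃ t, (s : ℕ) < t ∧ t ≤ n ∧ SiteActive Q σ t then 2 else 1

/-! ### The three relations -/

theorem isOrderRel_straddle : IsOrderRel RelStraddle where
  map φ hφ u v x y := by simp only [RelStraddle, hφ.lt_iff_lt]
  lt u v x y h := by unfold RelStraddle at h; omega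

theorem isOrderRel_between : IsOrderRel RelBetween where
  map φ hφ u v x y := by simp only [RelBetween, hφ.lt_iff_lt]
  lt u v x y h := by unfold RelBetween at h; omega

theorem isOrderRel_above : IsOrderRel RelAbove where
  map φ hφ u v x y := by simp only [RelAbove, hφ.lt_iff_lt]
  lt u v x y h := by unfold RelAbove at h; omega

/-- Every value other than that of the appended letter is taken by an old letter. -/
theorem exists_lift_eq {n s z : ℕ} (σ : Equiv.Perm (Fin n)) (hs : s < z) (hz : z ≤ n) :
    ∃ a, lift s (σ a) = z := by
  refine ⟨σ.symm ⟨z - 1, by omega⟩, ?_⟩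
  simp only [Equiv.apply_symm_apply, lift]
  split_ifs <;> omega

theorem siteActive_straddle_top {n : ℕ} (σ : Equiv.Perm (Fin n)) :
    SiteActive RelStraddle σ n := by
  intro a b c _ _ _ h
  have := (σ b).2
  unfold RelStraddle at h
  omega

theorem siteActive_above_of_le {n t : ℕ} (σ : Equiv.Perm (Fin n)) (ht : n ≤ t + 1) :
    SiteActive RelAbove σ t := by
  intro a b c hab _ _ h
  have h1 := (σ a).2
  have h2 := (σ b).2
  have := perm_val_ne σ hab
  unfold RelAbove at h
  omega

theorem siteActive_between_of_le {n s t : ℕ} {σ : Equiv.Perm (Fin n)}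
    (h : SiteActive RelBetween σ t) (hst : s ≤ t) : SiteActive RelBetween σ s := by
  intro a b c hab hac hbc hq
  refine h a b c hab hac hbc ?_
  unfold RelBetween at hq ⊢
  omega

theorem twoOrOneAbove_straddle : TwoOrOneAbove RelStraddle := by
  classical
  intro n σ s hs
  have hsn := Nat.lt_succ_iff.1 s.2
  have hset : (Finset.Ioc (s : ℕ) (n + 1)).filter (SiteActive RelStraddle (snoc σ s)) =
      {(s : ℕ) + 1, n + 1} := by
    ext t
    simp only [Finset.mem_filter, Finset.mem_Ioc, Finset.mem_insert, Finset.mem_singleton]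
    constructor
    · rintro ⟨⟨h1, h2⟩, h⟩
      rw [siteActive_snoc_of_gt isOrderRel_straddle σ h1] at h
      by_contra hne
      obtain ⟨a, ha⟩ := exists_lift_eq (s := s) (z := s + 1) σ (by omega) (by omega)
      obtain ⟨b, hb⟩ := exists_lift_eq (s := s) (z := t) σ (by omega) (by omega)
      refine h.2 a b (fun hab => by subst hab; omega) ?_
      rw [ha, hb]
      unfold RelStraddle
      omega
    · rintro (rfl | rfl)
      · refine ⟨by omega, ?_⟩
        rw [siteActive_snoc_of_gt isOrderRel_straddle σ (by omega)]
        refine ⟨hs, fun a b _ h => ?_⟩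
        unfold RelStraddle at h
        omega
      · exact ⟨by omega, siteActive_straddle_top _⟩
  rw [hset]
  split_ifs with h
  · obtain ⟨t, h1, h2, -⟩ := h
    rw [Finset.card_pair (by omega)]
  · have : (s : ℕ) = n := by
      by_contra hne
      exact h ⟨n, by omega, le_rfl, siteActive_straddle_top σ⟩
    simp [this]

theorem twoOrOneAbove_above : TwoOrOneAbove RelAbove := by
  classical
  intro n σ s hs
  have hsn := Nat.lt_succ_iff.1 s.2
  have hset : (Finset.Ioc (s : ℕ) (n + 1)).filter (SiteActive RelAbove (snoc σ s)) =
      Finset.Ioc (max (s : ℕ) (n - 1)) (n + 1) := by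
    ext t
    simp only [Finset.mem_filter, Finset.mem_Ioc]
    constructor
    · rintro ⟨⟨h1, h2⟩, h⟩
      rw [siteActive_snoc_of_gt isOrderRel_above σ h1] at h
      by_contra hne
      obtain ⟨a, ha⟩ := exists_lift_eq (s := s) (z := n) σ (by omega) (by omega)
      obtain ⟨b, hb⟩ := exists_lift_eq (s := s) (z := n - 1) σ (by omega) (by omega)
      refine h.2 a b (fun hab => by subst hab; omega) ?_
      rw [ha, hb]
      unfold RelAbove
      omega
    · intro h
      exact ⟨by omega, siteActive_above_of_le _ (by omega)⟩
  rw [hset, Nat.card_Ioc]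
  split_ifs with h
  · obtain ⟨t, h1, h2, -⟩ := h
    omega
  · have : (s : ℕ) = n := by
      by_contra hne
      exact h ⟨n, by omega, le_rfl, siteActive_above_of_le _ (by omega)⟩
    omega

theorem twoOrOneAbove_between : TwoOrOneAbove RelBetween := by
  classical
  intro n σ s hs
  have hsn := Nat.lt_succ_iff.1 s.2
  have hset : ∀ t, t ∈ (Finset.Ioc (s : ℕ) (n + 1)).filter (SiteActive RelBetween (snoc σ s)) ↔
      t = s + 1 ∨ t = s + 2 ∧ (s : ℕ) < n ∧ SiteActive RelBetween σ (s + 1) := by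
    intro t
    simp only [Finset.mem_filter, Finset.mem_Ioc]
    constructor
    · rintro ⟨⟨h1, h2⟩, h⟩
      rw [siteActive_snoc_of_gt isOrderRel_between σ h1] at h
      by_cases ht : t ≤ s + 2
      · rcases (show t = s + 1 ∨ t = s + 2 by omega) with rfl | rfl
        · exact Or.inl rfl
        · exact Or.inr ⟨rfl, by omega, h.1⟩
      · exfalso
        obtain ⟨a, ha⟩ := exists_lift_eq (s := s) (z := s + 1) σ (by omega) (by omega)
        obtain ⟨b, hb⟩ := exists_lift_eq (s := s) (z := s + 2) σ (by omega) (by omega)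
        refine h.2 a b (fun hab => by subst hab; omega) ?_
        rw [ha, hb]
        unfold RelBetween
        omega
    · rintro (rfl | ⟨rfl, h1, h2⟩)
      · refine ⟨by omega, ?_⟩
        rw [siteActive_snoc_of_gt isOrderRel_between σ (by omega)]
        refine ⟨hs, fun a b _ h => ?_⟩
        unfold RelBetween at h
        omega
      · refine ⟨by omega, ?_⟩
        rw [siteActive_snoc_of_gt isOrderRel_between σ (by omega)]
        refine ⟨h2, fun a b hab h => ?_⟩
        have h3 : lift s (σ a) ≠ lift s (σ b) :=
          fun h' => perm_val_ne σ hab ((strictMono_lift s).injective h')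
        unfold RelBetween at h
        omega
  split_ifs with h
  · obtain ⟨t, h1, h2, h3⟩ := h
    have h4 := siteActive_between_of_le h3 (show (s : ℕ) + 1 ≤ t from h1)
    have : (Finset.Ioc (s : ℕ) (n + 1)).filter (SiteActive RelBetween (snoc σ s)) =
        {(s : ℕ) + 1, (s : ℕ) + 2} := by
      ext t
      rw [hset]
      simp [h4, show (s : ℕ) < n by omega]
    rw [this, Finset.card_pair (by omega)]
  · rw [Finset.card_eq_one]
    refine ⟨s + 1, ?_⟩
    ext t
    rw [hset, Finset.mem_singleton, or_iff_left]
    rintro ⟨-, h1, h2⟩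
    exact h ⟨s + 1, by omega, h1, h2⟩

/-! ### The generating tree -/

/-- The weight of depth `m` descendants of a node of length `n` in the generating tree: a node
with `k` active sites, the lowest `a` of which lie below its last letter, has one child for each
active site, and the choice of one of the lowest `a` sites creates a descent at position `n`. -/
noncomputable def treeWeight {R : Type*} [CommRing R] (t : ℕ → R) : ℕ → ℕ → ℕ → ℕ → R
  | 0, _, _, _ => 1
  | m + 1, n, a, k => ∑ i ∈ Finset.Icc 1 k,
      (if i ≤ a then t n else 1) * treeWeight t m (n + 1) i (if i < k then i + 2 else i + 1)

open Classical in
/-- The set of active sites. -/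
noncomputable def sites (Q : ℕ → ℕ → ℕ → ℕ → Prop) {n : ℕ} (σ : Equiv.Perm (Fin n)) : Finset ℕ :=
  (Finset.range (n + 1)).filter (SiteActive Q σ)

open Classical in
/-- The active sites below the last letter; there are none if `σ` is empty. -/
noncomputable def lowSites (Q : ℕ → ℕ → ℕ → ℕ → Prop) {n : ℕ} (σ : Equiv.Perm (Fin n)) :
    Finset ℕ :=
  (sites Q σ).filter fun t => ∃ i : Fin n, (i : ℕ) + 1 = n ∧ t ≤ σ i

/-- Summing over a finite set by rank. -/
theorem sum_rank {M : Type*} [AddCommMonoid M] (A : Finset ℕ) (f : ℕ → M) :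
    ∑ t ∈ A, f (A.filter (· ≤ t)).card = ∑ i ∈ Finset.Icc 1 A.card, f i := by
  induction A using Finset.induction_on_max with
  | empty => simp
  | insert m A hm ih =>
    have hmA : m ∉ A := fun h => (hm m h).false
    rw [Finset.sum_insert hmA, Finset.card_insert_of_notMem hmA,
      Finset.sum_Icc_succ_top (by omega), ← ih, add_comm]
    congr 1
    · refine Finset.sum_congr rfl fun t ht => ?_
      rw [Finset.filter_insert, if_neg (not_le.2 (hm t ht))]
    · rw [Finset.filter_true_of_mem, Finset.card_insert_of_notMem hmA]
      intro t ht
      rcases Finset.mem_insert.1 ht with rfl | ht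
      · exact le_rfl
      · exact (hm t ht).le

theorem lowSites_snoc {Q : ℕ → ℕ → ℕ → ℕ → Prop} (hQ : IsOrderRel Q) {n : ℕ}
    (σ : Equiv.Perm (Fin n)) (s : Fin (n + 1)) :
    lowSites Q (snoc σ s) = (sites Q σ).filter (· ≤ (s : ℕ)) := by
  have hs := s.2
  ext t
  simp only [lowSites, sites, Finset.mem_filter, Finset.mem_range]
  constructor
  · rintro ⟨⟨h1, h2⟩, i, hi, h3⟩
    obtain rfl : i = Fin.last n := Fin.ext (by simpa using hi)
    rw [snoc_last] at h3
    rw [siteActive_snoc_of_le hQ σ h3] at h2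
    exact ⟨⟨by omega, h2⟩, h3⟩
  · rintro ⟨⟨h1, h2⟩, h3⟩
    refine ⟨⟨by omega, (siteActive_snoc_of_le hQ σ h3).2 h2⟩, Fin.last n, by simp, ?_⟩
    rwa [snoc_last]

theorem card_sites_snoc {Q : ℕ → ℕ → ℕ → ℕ → Prop} (hQ : IsOrderRel Q) (hQ' : TwoOrOneAbove Q)
    {n : ℕ} (σ : Equiv.Perm (Fin n)) (s : Fin (n + 1)) (hs : SiteActive Q σ s) :
    (sites Q (snoc σ s)).card =
      if ((sites Q σ).filter (· ≤ (s : ℕ))).card < (sites Q σ).card then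
        ((sites Q σ).filter (· ≤ (s : ℕ))).card + 2
      else ((sites Q σ).filter (· ≤ (s : ℕ))).card + 1 := by
  classical
  have hsn := s.2
  have h1 := Finset.card_filter_add_card_filter_not (s := sites Q (snoc σ s)) (· ≤ (s : ℕ))
  have h2 : (sites Q (snoc σ s)).filter (· ≤ (s : ℕ)) = (sites Q σ).filter (· ≤ (s : ℕ)) := by
    ext t
    simp only [sites, Finset.mem_filter, Finset.mem_range]
    constructor
    · rintro ⟨⟨_, h⟩, h3⟩
      exact ⟨⟨by omega, (siteActive_snoc_of_le hQ σ h3).1 h⟩, h3⟩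
    · rintro ⟨⟨_, h⟩, h3⟩
      exact ⟨⟨by omega, (siteActive_snoc_of_le hQ σ h3).2 h⟩, h3⟩
  have h3 : (sites Q (snoc σ s)).filter (fun t => ¬ t ≤ (s : ℕ)) =
      (Finset.Ioc (s : ℕ) (n + 1)).filter (SiteActive Q (snoc σ s)) := by
    ext t
    simp only [sites, Finset.mem_filter, Finset.mem_range, Finset.mem_Ioc]
    constructor
    · rintro ⟨⟨_, h⟩, h3⟩
      exact ⟨by omega, h⟩
    · rintro ⟨⟨_, _⟩, h⟩
      exact ⟨⟨by omega, h⟩, by omega⟩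
  rw [h2, h3, hQ' n σ s hs] at h1
  have h4 : (∃ t, (s : ℕ) < t ∧ t ≤ n ∧ SiteActive Q σ t) ↔
      ((sites Q σ).filter (· ≤ (s : ℕ))).card < (sites Q σ).card := by
    constructor
    · rintro ⟨t, ht, htn, h⟩
      refine Finset.card_lt_card ((Finset.filter_ssubset).2 ⟨t, ?_, by omega⟩)
      simp only [sites, Finset.mem_filter, Finset.mem_range]
      exact ⟨by omega, h⟩
    · intro h
      obtain ⟨t, ht, h⟩ := Finset.exists_mem_notMem_of_card_lt_card h
      simp only [Finset.mem_filter, not_and, ht, true_imp_iff] at h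
      simp only [sites, Finset.mem_filter, Finset.mem_range] at ht
      exact ⟨t, by omega, by omega, ht.2⟩
  simp only [h4] at h1
  rw [← h1]
  split_ifs <;> rfl

open Classical in
theorem sum_avoidsRel_succ {R : Type*} [AddCommMonoid R] {Q : ℕ → ℕ → ℕ → ℕ → Prop}
    (hQ : IsOrderRel Q) {n : ℕ} (F : Equiv.Perm (Fin (n + 1)) → R) :
    ∑ π ∈ Finset.univ.filter (fun π : Equiv.Perm (Fin (n + 1)) => AvoidsRel Q π), F π =
      ∑ σ ∈ Finset.univ.filter (fun σ : Equiv.Perm (Fin n) => AvoidsRel Q σ),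
        ∑ y ∈ Finset.univ.filter (fun y : Fin (n + 1) => SiteActive Q σ y), F (snoc σ y) := by
  simp only [Finset.sum_filter]
  rw [← (Equiv.ofBijective _ (snoc_bijective n)).sum_comp, Fintype.sum_prod_type]
  refine Finset.sum_congr rfl fun σ _ => ?_
  simp only [Equiv.ofBijective_apply, avoidsRel_snoc hQ]
  split_ifs with h
  · simp [h]
  · simp [h]

theorem lowSites_iff {Q : ℕ → ℕ → ℕ → ℕ → Prop} {n : ℕ} (σ : Equiv.Perm (Fin n)) {s : ℕ}
    (hs : s ∈ sites Q σ) :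
    (∃ i : Fin n, (i : ℕ) + 1 = n ∧ s ≤ σ i) ↔
      ((sites Q σ).filter (· ≤ s)).card ≤ (lowSites Q σ).card := by
  classical
  constructor
  · rintro ⟨i, hi, h⟩
    refine Finset.card_le_card fun t ht => ?_
    rw [Finset.mem_filter] at ht
    rw [lowSites, Finset.mem_filter]
    exact ⟨ht.1, i, hi, ht.2.trans h⟩
  · intro h
    by_contra hcon
    refine absurd (Finset.card_lt_card ?_) (not_lt.2 h)
    rw [Finset.ssubset_iff_of_subset]
    · refine ⟨s, by simp [hs], ?_⟩
      rw [lowSites, Finset.mem_filter]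
      exact fun h' => hcon h'.2
    · intro t ht
      rw [lowSites, Finset.mem_filter] at ht
      obtain ⟨h1, i, hi, h2⟩ := ht
      rw [Finset.mem_filter]
      refine ⟨h1, ?_⟩
      by_contra hlt
      exact hcon ⟨i, hi, by omega⟩

open Classical in
theorem sum_avoidsRel_eq_treeWeight_aux {R : Type*} [CommRing R] (t : ℕ → R)
    {Q : ℕ → ℕ → ℕ → ℕ → Prop} (hQ : IsOrderRel Q) (hQ' : TwoOrOneAbove Q) (m : ℕ) :
    ∀ n N : ℕ, n + m = N →
      ∑ π ∈ Finset.univ.filter (fun π : Equiv.Perm (Fin N) => AvoidsRel Q π), ∏ i ∈ DES π, t i =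
        ∑ σ ∈ Finset.univ.filter (fun σ : Equiv.Perm (Fin n) => AvoidsRel Q σ),
          (∏ i ∈ DES σ, t i) * treeWeight t m n (lowSites Q σ).card (sites Q σ).card := by
  induction m with
  | zero =>
    rintro n N rfl
    simp [treeWeight]
  | succ m ih =>
    intro n N h
    rw [ih (n + 1) N (by omega), sum_avoidsRel_succ hQ]
    refine Finset.sum_congr rfl fun σ _ => ?_
    rw [treeWeight, ← sum_rank, Finset.mul_sum]
    have hsites : sites Q σ = (Finset.univ.filter
        (fun y : Fin (n + 1) => SiteActive Q σ y)).map Fin.valEmbedding := by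
      ext s
      simp only [sites, Finset.mem_filter, Finset.mem_range, Finset.mem_map, Finset.mem_univ,
        true_and, Fin.valEmbedding_apply]
      constructor
      · rintro ⟨h1, h2⟩
        exact ⟨⟨s, h1⟩, h2, rfl⟩
      · rintro ⟨y, h1, rfl⟩
        exact ⟨y.2, h1⟩
    conv_rhs => rw [hsites, Finset.sum_map, ← hsites]
    refine Finset.sum_congr rfl fun y hy => ?_
    have hy' : SiteActive Q σ y := (Finset.mem_filter.1 hy).2
    have hys : (y : ℕ) ∈ sites Q σ := by
      simp only [sites, Finset.mem_filter, Finset.mem_range]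
      exact ⟨y.2, hy'⟩
    rw [lowSites_snoc hQ, card_sites_snoc hQ hQ' σ y hy', DES_snoc, ← mul_assoc]
    simp only [Fin.valEmbedding_apply, ← lowSites_iff σ hys]
    congr 1
    split_ifs
    · rw [Finset.prod_insert (notMem_DES_self σ), mul_comm]
    · rw [mul_one]

open Classical in
/-- The generating tree determines the descent set distribution. The empty permutation is its
root: it has one active site and no last letter. -/
theorem sum_avoidsRel_eq_treeWeight {R : Type*} [CommRing R] (t : ℕ → R)
    {Q : ℕ → ℕ → ℕ → ℕ → Prop} (hQ : IsOrderRel Q) (hQ' : TwoOrOneAbove Q) (N : ℕ) :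
    ∑ π ∈ Finset.univ.filter (fun π : Equiv.Perm (Fin N) => AvoidsRel Q π), ∏ i ∈ DES π, t i =
      treeWeight t N 0 0 1 := by
  rw [sum_avoidsRel_eq_treeWeight_aux t hQ hQ' N 0 N (zero_add N)]
  have h1 : ∀ σ : Equiv.Perm (Fin 0), lowSites Q σ = ∅ := by
    intro σ
    refine Finset.eq_empty_of_forall_notMem fun t ht => ?_
    rw [lowSites, Finset.mem_filter] at ht
    obtain ⟨-, i, -⟩ := ht
    exact i.elim0
  have h2 : ∀ σ : Equiv.Perm (Fin 0), sites Q σ = {0} := by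
    intro σ
    rw [sites, Finset.filter_true_of_mem]
    · rfl
    · exact fun _ _ a => a.elim0
  rw [Finset.filter_true_of_mem fun σ _ a => a.elim0]
  simp [h1, h2, DES]

theorem sum_avoiders_eq_treeWeight {R : Type*} [CommRing R] (t : ℕ → R)
    {Q : ℕ → ℕ → ℕ → ℕ → Prop} (hQ : IsOrderRel Q) (hQ' : TwoOrOneAbove Q) {P : Set (List ℕ)}
    (N : ℕ) (h : ∀ σ : Equiv.Perm (Fin N), σ ∈ avoiders N P ↔ AvoidsRel Q σ) :
    ∑ π ∈ avoiders N P, ∏ i ∈ DES π, t i = treeWeight t N 0 0 1 := by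
  classical
  rw [← sum_avoidsRel_eq_treeWeight t hQ hQ' N]
  refine Finset.sum_congr ?_ fun _ _ => rfl
  ext σ
  simp [h]

theorem desSetEquiv_straddle_between :
    DesSetEquiv {[2, 4, 1, 3], [4, 2, 1, 3]} {[2, 3, 1, 4], [3, 2, 1, 4]} := fun n => by
  rw [desSetPoly, desSetPoly,
    sum_avoiders_eq_treeWeight _ isOrderRel_straddle twoOrOneAbove_straddle n
      mem_avoiders_straddle,
    sum_avoiders_eq_treeWeight _ isOrderRel_between twoOrOneAbove_between n mem_avoiders_between]

theorem desSetEquiv_between_above :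
    DesSetEquiv {[2, 3, 1, 4], [3, 2, 1, 4]} {[3, 4, 1, 2], [4, 3, 1, 2]} := fun n => by
  rw [desSetPoly, desSetPoly,
    sum_avoiders_eq_treeWeight _ isOrderRel_between twoOrOneAbove_between n mem_avoiders_between,
    sum_avoiders_eq_treeWeight _ isOrderRel_above twoOrOneAbove_above n mem_avoiders_above]

/-! ### Separable permutations -/

/-- Avoidance of `2413` and `3142`. -/
def Separable {n : ℕ} (π : Equiv.Perm (Fin n)) : Prop :=
  ∀ a b c d : Fin n, a < b → b < c → c < d →
    ¬ (π c < π a ∧ π a < π d ∧ π d < π b) ∧ ¬ (π b < π d ∧ π d < π a ∧ π a < π c)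

theorem mem_avoiders_separable {n : ℕ} (π : Equiv.Perm (Fin n)) :
    π ∈ avoiders n {[2, 4, 1, 3], [3, 1, 4, 2]} ↔ Separable π := by
  simp only [mem_avoiders_pair, contains_four_iff, word, Separable, Fin.lt_def]
  constructor
  · rintro ⟨h1, h2⟩ a b c d hab hbc hcd
    exact ⟨fun h => h1 ⟨a, b, c, d, hab, hbc, hcd, by omega⟩,
      fun h => h2 ⟨a, b, c, d, hab, hbc, hcd, by omega⟩⟩
  · intro h
    constructor
    · rintro ⟨a, b, c, d, hab, hbc, hcd, h'⟩
      exact (h a b c d hab hbc hcd).1 (by omega)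
    · rintro ⟨a, b, c, d, hab, hbc, hcd, h'⟩
      exact (h a b c d hab hbc hcd).2 (by omega)

/-- The complement, obtained by reversing the order of the values. -/
def compl {n : ℕ} (π : Equiv.Perm (Fin n)) : Equiv.Perm (Fin n) := π.trans Fin.revPerm

@[simp]
theorem compl_apply {n : ℕ} (π : Equiv.Perm (Fin n)) (i : Fin n) :
    compl π i = Fin.rev (π i) := rfl

@[simp]
theorem compl_compl {n : ℕ} (π : Equiv.Perm (Fin n)) : compl (compl π) = π := by
  ext i
  simp

theorem separable_compl {n : ℕ} {π : Equiv.Perm (Fin n)} :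
    Separable (compl π) ↔ Separable π := by
  simp only [Separable, compl_apply, Fin.rev_lt_rev]
  constructor <;>
  · intro h a b c d hab hbc hcd
    have := h a b c d hab hbc hcd
    tauto

/-- Among the first `k` letters of `π`, the first `j` lie below the others, and both groups are
nonempty. -/
def IsCut {n : ℕ} (π : Equiv.Perm (Fin n)) (k j : ℕ) : Prop :=
  0 < j ∧ j < k ∧ ∀ a b : Fin n, (a : ℕ) < j → j ≤ (b : ℕ) → (b : ℕ) < k → π a < π b

/-- A sum decomposition of the first `k` letters extends to a sum or a skew decomposition of the
first `k + 1` letters: if the new letter `y` has letters of the lowest block both above and below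
it, then either these are arranged as `3 1` and complete a `3142` with `y` as `2`, or they cut the
lowest block into two. -/
theorem exists_isCut_succ {n : ℕ} {π : Equiv.Perm (Fin n)} (hπ : Separable π) {k : ℕ}
    (hk : k < n) (h : ∃ j, IsCut π k j) :
    ∃ j, IsCut π (k + 1) j ∨ IsCut (compl π) (k + 1) j := by
  classical
  obtain ⟨hj0, hjk, hj⟩ := Nat.find_spec h
  have hmin : ∀ i, i < Nat.find h → ¬ IsCut π k i := fun i hi => Nat.find_min h hi
  generalize Nat.find h = j at *
  set y : Fin n := ⟨k, hk⟩ with hy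
  have hlast : ∀ b : Fin n, (b : ℕ) < k + 1 → (b : ℕ) < k ∨ b = y := by
    intro b hb
    rcases (show (b : ℕ) < k ∨ (b : ℕ) = k by omega) with h | h
    · exact Or.inl h
    · exact Or.inr (Fin.ext h)
  by_cases h1 : ∀ a : Fin n, (a : ℕ) < j → π a < π y
  · refine ⟨j, Or.inl ⟨hj0, by omega, fun a b ha hb hbk => ?_⟩⟩
    rcases hlast b hbk with hb' | rfl
    · exact hj a b ha hb hb'
    · exact h1 a ha
  by_cases h2 : ∀ a : Fin n, (a : ℕ) < k → π y < π a
  · refine ⟨k, Or.inr ⟨by omega, by omega, fun a b ha hb hbk => ?_⟩⟩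
    rcases hlast b hbk with hb' | rfl
    · omega
    · simpa using h2 a ha
  exfalso
  have hne : ∀ a : Fin n, (a : ℕ) < k → π a ≠ π y := by
    intro a ha heq
    have := π.injective heq
    rw [this] at ha
    simp [hy] at ha
  push Not at h1 h2
  obtain ⟨u, huj, hu⟩ := h1
  replace hu : π y < π u := lt_of_le_of_ne hu (hne u (by omega)).symm
  obtain ⟨c, hck, hc⟩ := h2
  replace hc : π c < π y := lt_of_le_of_ne hc (hne c hck)
  have hcj : (c : ℕ) < j := by
    by_contra hcj
    exact absurd (hj u c huj (by omega) hck) (not_lt.2 (hc.trans hu).le)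
  -- No letter above `y` precedes a letter below `y` in the lowest block.
  have hord : ∀ a b : Fin n, a < b → (b : ℕ) < j → ¬ (π y < π a ∧ π b < π y) := by
    rintro a b hab hbj ⟨ha, hb⟩
    have hab' : (a : ℕ) < b := hab
    refine (hπ a b ⟨j, by omega⟩ y hab hbj hjk).2 ⟨hb, ha, ?_⟩
    exact hj _ _ (by omega) le_rfl hjk
  have hex : ∃ i : ℕ, ∃ a : Fin n, (a : ℕ) = i ∧ i < j ∧ π y < π a := ⟨u, u, rfl, huj, hu⟩
  obtain ⟨a, hai, hij, ha⟩ := Nat.find_spec hex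
  have hbelow : ∀ b : Fin n, (b : ℕ) < a → π b < π y := by
    intro b hb
    by_contra hcon
    have := Nat.find_min hex (m := b) (by omega)
    exact this ⟨b, rfl, by omega, lt_of_le_of_ne (not_lt.1 hcon) (hne b (by omega)).symm⟩
  refine hmin a (by omega) ⟨?_, by omega, fun b d hb hd hdk => ?_⟩
  · rcases Nat.eq_zero_or_pos (a : ℕ) with h0 | h0
    · exfalso
      have hac : a ≠ c := by
        rintro rfl
        exact absurd ha (not_lt.2 hc.le)
      have : (a : ℕ) ≠ c := fun h' => hac (Fin.ext h')
      exact hord a c (Fin.lt_def.2 (by omega)) hcj ⟨ha, hc⟩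
    · exact h0
  · by_cases hdj : (d : ℕ) < j
    · refine (hbelow b hb).trans ?_
      rcases hd.lt_or_eq with hd' | hd'
      · by_contra hcon
        exact hord a d hd' hdj ⟨ha, lt_of_le_of_ne (not_lt.1 hcon) (hne d hdk)⟩
      · rwa [← Fin.ext hd']
    · exact hj b d (by omega) (by omega) hdk

theorem exists_isCut_of_separable {n : ℕ} {π : Equiv.Perm (Fin n)} (hπ : Separable π) {k : ℕ}
    (h2 : 2 ≤ k) (hk : k ≤ n) : ∃ j, IsCut π k j ∨ IsCut (compl π) k j := by
  induction k, h2 using Nat.le_induction with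
  | base =>
    refine ⟨1, ?_⟩
    have key : ∀ τ : Equiv.Perm (Fin n), τ ⟨0, by omega⟩ < τ ⟨1, by omega⟩ → IsCut τ 2 1 := by
      intro τ h
      refine ⟨by omega, by omega, fun a b ha hb hb2 => ?_⟩
      rwa [show a = ⟨0, by omega⟩ from Fin.ext (by simp; omega),
        show b = ⟨1, by omega⟩ from Fin.ext (by simp; omega)]
    rcases lt_or_gt_of_ne (π.injective.ne (show (⟨0, by omega⟩ : Fin n) ≠ ⟨1, by omega⟩ by simp))
      with h | h
    · exact Or.inl (key π h)
    · exact Or.inr (key _ (by simpa using h))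
  | succ k h2 ih =>
    obtain ⟨j, h | h⟩ := ih (by omega)
    · exact exists_isCut_succ hπ hk ⟨j, h⟩
    · obtain ⟨i, h⟩ := exists_isCut_succ (separable_compl.2 hπ) hk ⟨j, h⟩
      rw [compl_compl] at h
      exact ⟨i, h.symm⟩

theorem not_isCut_and_isCut_compl {n : ℕ} {π : Equiv.Perm (Fin n)} {i j : ℕ}
    (h : IsCut π n i) (h' : IsCut (compl π) n j) : False := by
  obtain ⟨h1, h2, h3⟩ := h
  obtain ⟨h4, h5, h6⟩ := h'
  have h7 := h3 ⟨0, by omega⟩ ⟨n - 1, by omega⟩ h1 (by simp; omega) (by simp; omega)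
  have h8 := h6 ⟨0, by omega⟩ ⟨n - 1, by omega⟩ h4 (by simp; omega) (by simp; omega)
  rw [compl_apply, compl_apply, Fin.rev_lt_rev] at h8
  exact absurd h7 (not_lt.2 h8.le)

/-! ### Direct sums -/

/-- The direct sum of two permutations. -/
def dsum {j m : ℕ} (α : Equiv.Perm (Fin j)) (β : Equiv.Perm (Fin m)) :
    Equiv.Perm (Fin (j + m)) :=
  finSumFinEquiv.permCongr (Equiv.sumCongr α β)

@[simp]
theorem dsum_castAdd {j m : ℕ} (α : Equiv.Perm (Fin j)) (β : Equiv.Perm (Fin m)) (i : Fin j) :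
    dsum α β (Fin.castAdd m i) = Fin.castAdd m (α i) := by
  simp [dsum, Equiv.permCongr_apply]

@[simp]
theorem dsum_natAdd {j m : ℕ} (α : Equiv.Perm (Fin j)) (β : Equiv.Perm (Fin m)) (i : Fin m) :
    dsum α β (Fin.natAdd j i) = Fin.natAdd j (β i) := by
  simp [dsum, Equiv.permCongr_apply]

theorem dsum_injective (j m : ℕ) :
    Function.Injective fun p : Equiv.Perm (Fin j) × Equiv.Perm (Fin m) => dsum p.1 p.2 := by
  rintro ⟨α, β⟩ ⟨γ, δ⟩ h
  have h' : dsum α β = dsum γ δ := h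
  have h1 : α = γ := by
    ext i
    have := congrArg (fun π : Equiv.Perm (Fin (j + m)) => (π (Fin.castAdd m i) : ℕ)) h'
    simpa using this
  have h2 : β = δ := by
    ext i
    have := congrArg (fun π : Equiv.Perm (Fin (j + m)) => (π (Fin.natAdd j i) : ℕ)) h'
    simpa using this
  rw [h1, h2]

theorem val_lt_of_isCut {n j : ℕ} {π : Equiv.Perm (Fin n)} (h : IsCut π n j) {a : Fin n}
    (ha : (a : ℕ) < j) : (π a : ℕ) < j := by
  obtain ⟨h1, h2, h3⟩ := h
  -- The images of the `n - j` positions from `j` on all exceed `π a`.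
  have hsub : (Finset.Ici (⟨j, h2⟩ : Fin n)).map π.toEmbedding ⊆ Finset.Ioi (π a) := by
    intro x hx
    obtain ⟨b, hb, rfl⟩ := Finset.mem_map.1 hx
    exact Finset.mem_Ioi.2 (h3 a b ha (Fin.le_def.1 (Finset.mem_Ici.1 hb)) b.2)
  have := Finset.card_le_card hsub
  rw [Finset.card_map, Fin.card_Ici, Fin.card_Ioi] at this
  simp only at this
  omega

theorem exists_eq_dsum {j m : ℕ} {π : Equiv.Perm (Fin (j + m))} (h : IsCut π (j + m) j) :
    ∃ α β, π = dsum (j := j) (m := m) α β := by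
  have hmem := Equiv.Perm.mem_sumCongrHom_range_of_perm_mapsTo_inl
    (σ := (finSumFinEquiv (m := j) (n := m)).symm.permCongr π) (by
      rintro _ ⟨i, rfl⟩
      have hlt := val_lt_of_isCut h (a := Fin.castAdd m i) i.2
      refine ⟨⟨π (Fin.castAdd m i), hlt⟩, ?_⟩
      rw [Equiv.permCongr_apply, Equiv.symm_symm, finSumFinEquiv_apply_left,
        Equiv.eq_symm_apply, finSumFinEquiv_apply_left]
      rfl)
  obtain ⟨⟨α, β⟩, hαβ⟩ := hmem
  refine ⟨α, β, ?_⟩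
  have : Equiv.sumCongr α β = (finSumFinEquiv (m := j) (n := m)).symm.permCongr π := hαβ
  rw [dsum, this]
  ext i
  simp [Equiv.permCongr_apply]

theorem isCut_dsum {j m : ℕ} (hj : 0 < j) (hm : 0 < m) (α : Equiv.Perm (Fin j))
    (β : Equiv.Perm (Fin m)) : IsCut (dsum α β) (j + m) j := by
  refine ⟨hj, by omega, fun a b ha hb _ => ?_⟩
  induction a using Fin.addCases with
  | right a => simp at ha
  | left a =>
    induction b using Fin.addCases with
    | left b => have := b.2; simp at hb; omega
    | right b =>
      have := (α a).2
      simp only [dsum_castAdd, dsum_natAdd, Fin.lt_def, Fin.val_castAdd, Fin.val_natAdd]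
      omega

theorem isCut_dsum_iff_of_lt {j m i : ℕ} (hij : i < j) (α : Equiv.Perm (Fin j))
    (β : Equiv.Perm (Fin m)) : IsCut (dsum α β) (j + m) i ↔ IsCut α j i := by
  constructor
  · rintro ⟨h1, -, h3⟩
    refine ⟨h1, hij, fun a b ha hb _ => ?_⟩
    have := h3 (Fin.castAdd m a) (Fin.castAdd m b) ha hb (Fin.castAdd m b).2
    simpa only [dsum_castAdd, dsum_natAdd, Fin.lt_def, Fin.val_castAdd, Fin.val_natAdd,
        add_lt_add_iff_left] using this
  · rintro ⟨h1, -, h3⟩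
    refine ⟨h1, by omega, fun a b ha hb _ => ?_⟩
    induction a using Fin.addCases with
    | right a => simp at ha; omega
    | left a =>
      induction b using Fin.addCases with
      | left b =>
        have := h3 a b ha hb b.2
        simpa only [dsum_castAdd, dsum_natAdd, Fin.lt_def, Fin.val_castAdd, Fin.val_natAdd,
        add_lt_add_iff_left] using this
      | right b =>
        have := (α a).2
        simp only [dsum_castAdd, dsum_natAdd, Fin.lt_def, Fin.val_castAdd, Fin.val_natAdd]
        omega

theorem separable_dsum_iff {j m : ℕ} (α : Equiv.Perm (Fin j)) (β : Equiv.Perm (Fin m)) :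
    Separable (dsum α β) ↔ Separable α ∧ Separable β := by
  constructor
  · intro h
    constructor
    · intro a b c d hab hbc hcd
      have := h (Fin.castAdd m a) (Fin.castAdd m b) (Fin.castAdd m c) (Fin.castAdd m d) hab hbc hcd
      simpa only [dsum_castAdd, dsum_natAdd, Fin.lt_def, Fin.val_castAdd, Fin.val_natAdd,
        add_lt_add_iff_left] using this
    · intro a b c d hab hbc hcd
      have := h (Fin.natAdd j a) (Fin.natAdd j b) (Fin.natAdd j c) (Fin.natAdd j d)
        (by simpa using hab) (by simpa using hbc) (by simpa using hcd)
      simpa only [dsum_castAdd, dsum_natAdd, Fin.lt_def, Fin.val_castAdd, Fin.val_natAdd,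
        add_lt_add_iff_left] using this
  · rintro ⟨hα, hβ⟩ a b c d hab hbc hcd
    -- An occurrence of a sum indecomposable pattern stays within one summand.
    induction a using Fin.addCases with
    | left a =>
      induction d using Fin.addCases with
      | left d =>
        obtain ⟨c, rfl⟩ : ∃ c', c = Fin.castAdd m c' :=
          ⟨⟨c, lt_trans (Fin.lt_def.1 hcd) d.2⟩, rfl⟩
        obtain ⟨b, rfl⟩ : ∃ b', b = Fin.castAdd m b' :=
          ⟨⟨b, lt_trans (Fin.lt_def.1 hbc) c.2⟩, rfl⟩
        simpa only [dsum_castAdd, dsum_natAdd, Fin.lt_def, Fin.val_castAdd, Fin.val_natAdd,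
        add_lt_add_iff_left] using hα a b c d hab hbc hcd
      | right d =>
        have ha' := (α a).2
        induction b using Fin.addCases with
        | left b =>
          have hb' := (α b).2
          induction c using Fin.addCases with
          | left c =>
            have hc' := (α c).2
            simp only [dsum_castAdd, dsum_natAdd, Fin.lt_def, Fin.val_castAdd, Fin.val_natAdd]
            omega
          | right c =>
            simp only [dsum_castAdd, dsum_natAdd, Fin.lt_def, Fin.val_castAdd, Fin.val_natAdd]
            omega
        | right b =>
          induction c using Fin.addCases with
          | left c =>
            have := c.2
            simp only [Fin.lt_def, Fin.val_castAdd, Fin.val_natAdd] at hbc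
            omega
          | right c =>
            simp only [dsum_castAdd, dsum_natAdd, Fin.lt_def, Fin.val_castAdd, Fin.val_natAdd]
            omega
    | right a =>
      have key : ∀ x : Fin (j + m), Fin.natAdd j a < x → ∃ x', x = Fin.natAdd j x' := by
        intro x hx
        rw [Fin.lt_def, Fin.val_natAdd] at hx
        exact ⟨⟨x - j, by omega⟩, Fin.ext (by simp; omega)⟩
      obtain ⟨b', rfl⟩ := key b hab
      obtain ⟨c', rfl⟩ := key c (hab.trans hbc)
      obtain ⟨d', rfl⟩ := key d ((hab.trans hbc).trans hcd)
      simpa only [dsum_castAdd, dsum_natAdd, Fin.lt_def, Fin.val_castAdd, Fin.val_natAdd,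
        add_lt_add_iff_left] using hβ a b' c' d' (by simpa using hab) (by simpa using hbc)
        (by simpa using hcd)

theorem DES_dsum {j m : ℕ} (α : Equiv.Perm (Fin j)) (β : Equiv.Perm (Fin m)) :
    DES (dsum α β) = DES α ∪ (DES β).map (addLeftEmbedding j) := by
  ext i
  simp only [DES, Finset.mem_union, Finset.mem_map, Finset.mem_filter, Finset.mem_Icc, word,
    add_lt_add_iff_right, addLeftEmbedding_apply]
  constructor
  · rintro ⟨hi, a, b, ha, hb, h⟩
    induction a using Fin.addCases with
    | left a =>
      induction b using Fin.addCases with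
      | left b =>
        left
        have := b.2
        simp only [Fin.val_castAdd, dsum_castAdd] at ha hb h
        exact ⟨by omega, a, b, ha, hb, h⟩
      | right b =>
        have := (α a).2
        simp only [Fin.val_castAdd, Fin.val_natAdd, dsum_castAdd, dsum_natAdd] at h
        omega
    | right a =>
      induction b using Fin.addCases with
      | left b =>
        have := b.2
        simp only [Fin.val_castAdd, Fin.val_natAdd] at ha hb
        omega
      | right b =>
        right
        have := b.2
        simp only [Fin.val_natAdd, dsum_natAdd, add_lt_add_iff_left] at ha hb h
        exact ⟨b, ⟨by omega, a, b, by omega, rfl, h⟩, hb⟩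
  · rintro (⟨hi, a, b, ha, hb, h⟩ | ⟨i, ⟨hi, a, b, ha, hb, h⟩, rfl⟩)
    · exact ⟨by omega, Fin.castAdd m a, Fin.castAdd m b, by simpa using ha, by simpa using hb,
        by simpa using h⟩
    · exact ⟨by omega, Fin.natAdd j a, Fin.natAdd j b, by simp; omega, by simp; omega,
        by simpa using h⟩

theorem des_dsum {j m : ℕ} (α : Equiv.Perm (Fin j)) (β : Equiv.Perm (Fin m)) :
    des (dsum α β) = des α + des β := by
  rw [des, DES_dsum, Finset.card_union_of_disjoint, Finset.card_map, des, des]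
  rw [Finset.disjoint_left]
  intro i hi hi'
  obtain ⟨k, hk, rfl⟩ := Finset.mem_map.1 hi'
  simp only [DES, Finset.mem_filter, Finset.mem_Icc, addLeftEmbedding_apply] at hi hk
  omega

theorem des_le {n : ℕ} (π : Equiv.Perm (Fin n)) : des π ≤ n - 1 := by
  refine (Finset.card_filter_le _ _).trans ?_
  simp

theorem des_compl {n : ℕ} (π : Equiv.Perm (Fin n)) : des (compl π) = n - 1 - des π := by
  have : DES (compl π) = Finset.Icc 1 (n - 1) \ DES π := by
    ext i
    simp only [DES, Finset.mem_sdiff, Finset.mem_filter, Finset.mem_Icc, word,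
      add_lt_add_iff_right, compl_apply, ← Fin.lt_def, Fin.rev_lt_rev]
    constructor
    · rintro ⟨hi, a, b, ha, hb, h⟩
      refine ⟨hi, ?_⟩
      rintro ⟨-, a', b', ha', hb', h'⟩
      obtain rfl : a' = a := Fin.ext (by omega)
      obtain rfl : b' = b := Fin.ext (by omega)
      exact absurd h (not_lt.2 h'.le)
    · rintro ⟨hi, h⟩
      refine ⟨hi, ⟨i - 1, by omega⟩, ⟨i, by omega⟩, by simp; omega, rfl, ?_⟩
      by_contra hcon
      refine h ⟨hi, ⟨i - 1, by omega⟩, ⟨i, by omega⟩, by simp; omega, rfl, ?_⟩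
      refine lt_of_le_of_ne (not_lt.1 hcon) (π.injective.ne ?_)
      simp only [ne_eq, Fin.mk.injEq]
      omega
  have hsub : DES π ⊆ Finset.Icc 1 (n - 1) := Finset.filter_subset _ _
  rw [des, this, Finset.card_sdiff_of_subset hsub, Nat.card_Icc, des]
  rfl

/-! ### Generating series of separable permutations -/

/-- The weight `p ^ asc π * q ^ des π`. -/
def weight {R : Type*} [CommRing R] (p q : R) {n : ℕ} (π : Equiv.Perm (Fin n)) : R :=
  p ^ (n - 1 - des π) * q ^ des π

theorem weight_compl {R : Type*} [CommRing R] (p q : R) {n : ℕ} (π : Equiv.Perm (Fin n)) :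
    weight p q (compl π) = weight q p π := by
  have := des_le π
  rw [weight, weight, des_compl, Nat.sub_sub_self this, mul_comm]

theorem weight_dsum {R : Type*} [CommRing R] (p q : R) {j m : ℕ} (hj : 0 < j) (hm : 0 < m)
    (α : Equiv.Perm (Fin j)) (β : Equiv.Perm (Fin m)) :
    weight p q (dsum α β) = p * (weight p q α * weight p q β) := by
  have h1 := des_le α
  have h2 := des_le β
  rw [weight, weight, weight, des_dsum,
    show j + m - 1 - (des α + des β) = (j - 1 - des α) + (m - 1 - des β) + 1 by omega]
  ring

open Classical in
/-- The weighted count of the separable permutations of length `n`. -/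
noncomputable def sepSum {R : Type*} [CommRing R] (p q : R) (n : ℕ) : R :=
  ∑ π ∈ Finset.univ.filter (fun π : Equiv.Perm (Fin n) => Separable π), weight p q π

open Classical in
/-- The weighted count of the sum indecomposable separable permutations of length `n`. -/
noncomputable def indecSum {R : Type*} [CommRing R] (p q : R) (n : ℕ) : R :=
  ∑ π ∈ Finset.univ.filter (fun π : Equiv.Perm (Fin n) => Separable π ∧ ∀ i, ¬ IsCut π n i),
    weight p q π

theorem sepSum_swap {R : Type*} [CommRing R] (p q : R) (n : ℕ) :
    sepSum p q n = sepSum q p n := by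
  classical
  refine Finset.sum_nbij' compl compl ?_ ?_ (fun π _ => compl_compl π)
    (fun π _ => compl_compl π) (fun π _ => (weight_compl q p π).symm)
  all_goals
    intro π hπ
    simpa [separable_compl] using hπ

open Classical in
theorem indecSum_swap {R : Type*} [CommRing R] (p q : R) (n : ℕ) :
    indecSum q p n = ∑ π ∈ Finset.univ.filter
      (fun π : Equiv.Perm (Fin n) => Separable π ∧ ∀ i, ¬ IsCut (compl π) n i), weight p q π := by
  refine Finset.sum_nbij' compl compl ?_ ?_ (fun π _ => compl_compl π)
    (fun π _ => compl_compl π) (fun π _ => (weight_compl p q π).symm)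
  all_goals
    intro π hπ
    simpa [separable_compl] using hπ

theorem indecSum_add_swap {R : Type*} [CommRing R] (p q : R) {n : ℕ} (hn : 2 ≤ n) :
    indecSum p q n + indecSum q p n = sepSum p q n := by
  classical
  rw [indecSum_swap p q, indecSum, sepSum, ← Finset.sum_union]
  · refine Finset.sum_congr ?_ fun _ _ => rfl
    ext π
    simp only [Finset.mem_union, Finset.mem_filter, Finset.mem_univ, true_and, ← and_or_left,
      and_iff_left_iff_imp]
    intro _
    by_contra hcon
    push Not at hcon
    obtain ⟨⟨i, hi⟩, j, hj⟩ := hcon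
    exact not_isCut_and_isCut_compl hi hj
  · rw [Finset.disjoint_left]
    intro π h1 h2
    simp only [Finset.mem_filter, Finset.mem_univ, true_and] at h1 h2
    obtain ⟨j, h | h⟩ := exists_isCut_of_separable h1.1 hn le_rfl
    · exact h1.2 j h
    · exact h2.2 j h

theorem not_isCut_of_le_one {n : ℕ} (hn : n ≤ 1) (π : Equiv.Perm (Fin n)) (i : ℕ) :
    ¬ IsCut π n i := by
  rintro ⟨h1, h2, -⟩
  omega

theorem separable_of_le_one {n : ℕ} (hn : n ≤ 1) (π : Equiv.Perm (Fin n)) : Separable π := by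
  intro a b c d hab
  have h := b.2
  rw [Fin.lt_def] at hab
  omega

theorem indecSum_eq_sepSum {R : Type*} [CommRing R] (p q : R) {n : ℕ} (hn : n ≤ 1) :
    indecSum p q n = sepSum p q n := by
  classical
  rw [indecSum, sepSum]
  refine Finset.sum_congr ?_ fun _ _ => rfl
  ext π
  simp [not_isCut_of_le_one hn]

theorem sepSum_of_le_one {R : Type*} [CommRing R] (p q : R) {n : ℕ} (hn : n ≤ 1) :
    sepSum p q n = 1 := by
  classical
  have h1 : ∀ π : Equiv.Perm (Fin n), weight p q π = 1 := by
    intro π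
    have := des_le π
    rw [weight, show des π = 0 by omega, show n - 1 - 0 = 0 by omega]
    simp
  rw [sepSum, Finset.filter_true_of_mem fun π _ => separable_of_le_one hn π]
  simp only [h1, Finset.sum_const, Finset.card_univ, Fintype.card_perm, Fintype.card_fin]
  interval_cases n <;> simp

open Classical in
/-- Separable permutations whose first block in the finest sum decomposition has length `j`. -/
theorem sum_firstCut {R : Type*} [CommRing R] (p q : R) {j m : ℕ} (hj : 0 < j) (hm : 0 < m) :
    ∑ π ∈ Finset.univ.filter (fun π : Equiv.Perm (Fin (j + m)) => Separable π ∧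
      IsCut π (j + m) j ∧ ∀ i < j, ¬ IsCut π (j + m) i), weight p q π =
      p * (indecSum p q j * sepSum p q m) := by
  rw [indecSum, sepSum, Finset.sum_mul_sum, ← Finset.sum_product', Finset.mul_sum]
  symm
  refine Finset.sum_bij (fun x _ => dsum x.1 x.2) ?_ (fun x _ y _ h => dsum_injective j m h) ?_
    (fun x _ => (weight_dsum p q hj hm x.1 x.2).symm)
  · rintro ⟨α, β⟩ h
    simp only [Finset.mem_product, Finset.mem_filter, Finset.mem_univ, true_and] at h ⊢
    refine ⟨(separable_dsum_iff α β).2 ⟨h.1.1, h.2⟩, isCut_dsum hj hm α β, fun i hi hcut => ?_⟩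
    exact h.1.2 i ((isCut_dsum_iff_of_lt hi α β).1 hcut)
  · intro π h
    simp only [Finset.mem_filter, Finset.mem_univ, true_and] at h
    obtain ⟨hsep, hcut, hfirst⟩ := h
    obtain ⟨α, β, rfl⟩ := exists_eq_dsum hcut
    rw [separable_dsum_iff] at hsep
    refine ⟨(α, β), ?_, rfl⟩
    simp only [Finset.mem_product, Finset.mem_filter, Finset.mem_univ, true_and]
    refine ⟨⟨hsep.1, fun i hi => ?_⟩, hsep.2⟩
    exact hfirst i hi.2.1 ((isCut_dsum_iff_of_lt hi.2.1 α β).2 hi)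

open Classical in
theorem sepSum_eq_indecSum_add {R : Type*} [CommRing R] (p q : R) (n : ℕ) :
    sepSum p q n = indecSum p q n + ∑ x ∈ Finset.HasAntidiagonal.antidiagonal n,
      if 0 < x.1 ∧ 0 < x.2 then p * (indecSum p q x.1 * sepSum p q x.2) else 0 := by
  have h0 : sepSum p q n = indecSum p q n +
      ∑ π ∈ Finset.univ.filter (fun π : Equiv.Perm (Fin n) => Separable π ∧ ∃ i, IsCut π n i),
        weight p q π := by
    rw [sepSum, indecSum, ← Finset.sum_filter_add_sum_filter_not _ (fun π => ∀ i, ¬ IsCut π n i),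
      Finset.filter_filter, Finset.filter_filter]
    simp only [not_forall, not_not]
  rw [h0]
  congr 1
  -- The length of the first block; without a cut it has the junk value `0`, which is not used.
  set first : Equiv.Perm (Fin n) → ℕ := fun π => sInf {i | IsCut π n i}
  have hmem : ∀ π : Equiv.Perm (Fin n), (∃ i, IsCut π n i) → IsCut π n (first π) :=
    fun π h => Nat.sInf_mem h
  rw [← Finset.sum_fiberwise_of_maps_to (g := fun π => (first π, n - first π))
    (t := Finset.HasAntidiagonal.antidiagonal n)]
  · refine Finset.sum_congr rfl ?_
    rintro ⟨j, m⟩ hjm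
    rw [Finset.HasAntidiagonal.mem_antidiagonal] at hjm
    simp only at hjm
    subst hjm
    split_ifs with hpos
    · rw [← sum_firstCut p q hpos.1 hpos.2]
      refine Finset.sum_congr ?_ fun _ _ => rfl
      ext π
      simp only [Finset.mem_filter, Finset.mem_univ, true_and, Prod.mk.injEq]
      constructor
      · rintro ⟨⟨h1, h2⟩, h3, -⟩
        have h4 := hmem π h2
        rw [h3] at h4
        refine ⟨h1, h4, fun i hi => ?_⟩
        rw [← h3] at hi
        exact Nat.notMem_of_lt_sInf hi
      · rintro ⟨h1, h2, h3⟩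
        have h4 : first π = j := by
          refine le_antisymm (Nat.sInf_le h2) ?_
          by_contra hlt
          exact h3 _ (not_le.1 hlt) (hmem π ⟨j, h2⟩)
        exact ⟨⟨h1, j, h2⟩, h4, by omega⟩
    · refine Finset.sum_eq_zero fun π hπ => ?_
      simp only [Finset.mem_filter, Finset.mem_univ, true_and, Prod.mk.injEq] at hπ
      obtain ⟨⟨-, h2⟩, h3, -⟩ := hπ
      obtain ⟨h4, h5, -⟩ := hmem π h2
      omega
  · intro π hπ
    simp only [Finset.mem_filter, Finset.mem_univ, true_and] at hπ
    have := (hmem π hπ.2).2.1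
    rw [Finset.HasAntidiagonal.mem_antidiagonal]
    simp only
    omega

/-- The generating series of nonempty separable permutations. -/
noncomputable def sepSeries {R : Type*} [CommRing R] (p q : R) : PowerSeries R :=
  PowerSeries.mk fun n => if n = 0 then 0 else sepSum p q n

/-- The generating series of nonempty sum indecomposable separable permutations. -/
noncomputable def indecSeries {R : Type*} [CommRing R] (p q : R) : PowerSeries R :=
  PowerSeries.mk fun n => if n = 0 then 0 else indecSum p q n

theorem sepSeries_swap {R : Type*} [CommRing R] (p q : R) : sepSeries p q = sepSeries q p := by
  ext n
  simp only [sepSeries, PowerSeries.coeff_mk, sepSum_swap p q n]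

theorem sepSeries_eq {R : Type*} [CommRing R] (p q : R) :
    sepSeries p q = indecSeries p q + PowerSeries.C p * (indecSeries p q * sepSeries p q) := by
  ext n
  rw [map_add, PowerSeries.coeff_C_mul, PowerSeries.coeff_mul, Finset.mul_sum]
  simp only [sepSeries, indecSeries, PowerSeries.coeff_mk]
  split_ifs with hn
  · subst hn
    simp
  · rw [sepSum_eq_indecSum_add]
    congr 1
    refine Finset.sum_congr rfl fun x _ => ?_
    by_cases h1 : x.1 = 0 <;> by_cases h2 : x.2 = 0 <;> simp [h1, h2, Nat.pos_iff_ne_zero]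

theorem indecSeries_add_swap {R : Type*} [CommRing R] (p q : R) :
    indecSeries p q + indecSeries q p = sepSeries p q + PowerSeries.X := by
  ext n
  rw [map_add, map_add, PowerSeries.coeff_X]
  simp only [sepSeries, indecSeries, PowerSeries.coeff_mk]
  rcases (show n = 0 ∨ n = 1 ∨ 2 ≤ n by omega) with rfl | rfl | hn
  · simp
  · simp [indecSum_eq_sepSum, sepSum_of_le_one]
  · rw [if_neg (by omega), if_neg (by omega), if_neg (by omega), if_neg (by omega), add_zero,
      indecSum_add_swap p q hn]

/-- With weight `t ^ des`, the series `S` of nonempty separable permutations satisfies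
`S - t S³ = x (1 + S) (1 + t S)`. -/
theorem sepSeries_cubic {R : Type*} [CommRing R] (t : R) :
    PowerSeries.X * (1 + sepSeries 1 t) * (1 + PowerSeries.C t * sepSeries 1 t) =
      sepSeries 1 t * (1 - PowerSeries.C t * sepSeries 1 t ^ 2) := by
  have h1 := sepSeries_eq 1 t
  have h2 := sepSeries_eq t 1
  have h3 := indecSeries_add_swap 1 t
  rw [sepSeries_swap t 1] at h2
  rw [map_one, one_mul] at h1
  generalize sepSeries 1 t = S at *
  generalize indecSeries 1 t = I at *
  generalize indecSeries t 1 = J at *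
  generalize PowerSeries.C t = T at *
  linear_combination (-(1 + S) * (1 + T * S)) * h3 - (1 + T * S) * h1 - (1 + S) * h2

/-! ### Solving the generating tree -/

/-- The weight of depth `m` descendants when every descent has weight `t`; see `treeWeight`. -/
noncomputable def treeCount {R : Type*} [CommRing R] (t : R) (m a k : ℕ) : R :=
  treeWeight (fun _ => t) m 0 a k

theorem treeWeight_const {R : Type*} [CommRing R] (t : R) (m n a k : ℕ) :
    treeWeight (fun _ => t) m n a k = treeCount t m a k := by
  have key : ∀ m n n' a k, treeWeight (fun _ => t) m n a k = treeWeight (fun _ => t) m n' a k := by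
    intro m
    induction m with
    | zero => intros; rfl
    | succ m ih =>
      intro n n' a k
      simp only [treeWeight]
      refine Finset.sum_congr rfl fun i _ => ?_
      rw [ih (n + 1) (n' + 1)]
  exact key m n 0 a k

theorem treeCount_zero {R : Type*} [CommRing R] (t : R) (a k : ℕ) : treeCount t 0 a k = 1 := rfl

theorem treeCount_succ {R : Type*} [CommRing R] (t : R) (m a k : ℕ) :
    treeCount t (m + 1) a k = ∑ i ∈ Finset.Icc 1 k,
      (if i ≤ a then t else 1) * treeCount t m i (if i < k then i + 2 else i + 1) := by
  rw [treeCount, treeWeight]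
  simp only [treeWeight_const]

theorem sum_low_sites {R : Type*} [CommRing R] (t : R) (m a k : ℕ) (hk : a < k) :
    ∑ i ∈ Finset.Icc 1 a, (if i ≤ a then t else 1) *
      treeCount t m i (if i < k then i + 2 else i + 1) =
    t * ∑ i ∈ Finset.Icc 1 a, treeCount t m i (i + 2) := by
  rw [Finset.mul_sum]
  refine Finset.sum_congr rfl fun i hi => ?_
  rw [Finset.mem_Icc] at hi
  rw [if_pos hi.2, if_pos (by omega)]

theorem treeCount_succ_one {R : Type*} [CommRing R] (t : R) (m a : ℕ) :
    treeCount t (m + 1) a (a + 1) =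
      t * ∑ i ∈ Finset.Icc 1 a, treeCount t m i (i + 2) + treeCount t m (a + 1) (a + 2) := by
  rw [treeCount_succ, Finset.sum_Icc_succ_top (by omega), sum_low_sites t m a _ (by omega)]
  simp

theorem treeCount_succ_two {R : Type*} [CommRing R] (t : R) (m a : ℕ) :
    treeCount t (m + 1) a (a + 2) =
      t * ∑ i ∈ Finset.Icc 1 a, treeCount t m i (i + 2) + treeCount t m (a + 1) (a + 3) +
        treeCount t m (a + 2) (a + 3) := by
  rw [treeCount_succ, Finset.sum_Icc_succ_top (by omega), Finset.sum_Icc_succ_top (by omega),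
    sum_low_sites t m a _ (by omega)]
  simp

/-- The system of the generating tree has at most one solution in power series; here `F a` and
`G a` belong to the nodes with `a` active sites below the last letter and with one, respectively
two, above it. -/
theorem coeff_eq_treeCount {R : Type*} [CommRing R] (t : R) (F G : ℕ → PowerSeries R)
    (hF : ∀ a, F a = 1 + PowerSeries.X *
      (PowerSeries.C t * ∑ i ∈ Finset.Icc 1 a, G i + F (a + 1)))
    (hG : ∀ a, G a = 1 + PowerSeries.X *
      (PowerSeries.C t * ∑ i ∈ Finset.Icc 1 a, G i + G (a + 1) + F (a + 2))) (m : ℕ) :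
    ∀ a, PowerSeries.coeff m (F a) = treeCount t m a (a + 1) ∧
      PowerSeries.coeff m (G a) = treeCount t m a (a + 2) := by
  induction m with
  | zero =>
    intro a
    rw [hF, hG]
    simp [treeCount_zero]
  | succ m ih =>
    intro a
    rw [hF, hG, treeCount_succ_one, treeCount_succ_two]
    simp only [map_add, PowerSeries.coeff_succ_X_mul, PowerSeries.coeff_C_mul, map_sum,
      (ih _).1, (ih _).2, PowerSeries.coeff_one, Nat.add_eq_zero_iff, one_ne_zero, and_false,
      if_false, zero_add, and_self]

/-- The solution of the system is geometric in `a`. With `S` the series of nonempty separable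
permutations, `U = (1 - t S²)⁻¹` and `r = (1 + t S) U`, one has `F a = (1 + S) r ^ a` and
`G a = (1 + S)² U r ^ a`. -/
theorem coeff_one_add_sepSeries {R : Type*} [CommRing R] (t : R) (m : ℕ) :
    PowerSeries.coeff m (1 + sepSeries 1 t) = treeCount t m 0 1 := by
  have hcubic := sepSeries_cubic t
  have hS0 : PowerSeries.constantCoeff (sepSeries 1 t) = 0 := by
    simp [sepSeries]
  generalize sepSeries 1 t = S at *
  generalize hT : PowerSeries.C t = T at *
  obtain ⟨U, hU⟩ : ∃ U, (1 - T * S ^ 2) * U = 1 := by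
    have : IsUnit (1 - T * S ^ 2) := by
      rw [PowerSeries.isUnit_iff_constantCoeff]
      simp [hS0]
    exact this.exists_right_inv
  set r := (1 + T * S) * U with hr
  -- `x r (1 + S) = S`, and `r - 1 = t S (1 + S) U`.
  have hxr : PowerSeries.X * (1 + S) * r = S := by
    rw [hr]
    linear_combination U * hcubic + S * hU
  have hr1 : r - 1 = T * S * (1 + S) * U := by
    rw [hr]
    linear_combination hU
  clear_value r
  have hF : ∀ a : ℕ, (1 + S) * r ^ a = 1 + PowerSeries.X *
      (T * ∑ i ∈ Finset.Icc 1 a, (1 + S) ^ 2 * U * r ^ i + (1 + S) * r ^ (a + 1)) := by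
    intro a
    induction a with
    | zero =>
      simp only [Finset.Icc_eq_empty (show ¬ (1 : ℕ) ≤ 0 by omega), Finset.sum_empty]
      linear_combination -hxr
    | succ a ih =>
      rw [Finset.sum_Icc_succ_top (by omega)]
      linear_combination ih + r ^ a * hr1 - r ^ a * (T * (1 + S) * U + (r - 1)) * hxr
  have hG : ∀ a : ℕ, (1 + S) ^ 2 * U * r ^ a = 1 + PowerSeries.X *
      (T * ∑ i ∈ Finset.Icc 1 a, (1 + S) ^ 2 * U * r ^ i + (1 + S) ^ 2 * U * r ^ (a + 1) +
        (1 + S) * r ^ (a + 2)) := by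
    intro a
    linear_combination hF a + r ^ a * (1 + S) * hU - r ^ a * S * hr1 -
      r ^ a * ((1 + S) * U + (r - 1)) * hxr
  subst hT
  have := (coeff_eq_treeCount t _ _ hF hG m 0).1
  simpa using this

theorem desNumberEquiv_separable_straddle :
    DesNumberEquiv {[2, 4, 1, 3], [3, 1, 4, 2]} {[2, 4, 1, 3], [4, 2, 1, 3]} := by
  classical
  intro n
  have h1 : desPoly n {[2, 4, 1, 3], [4, 2, 1, 3]} = treeCount Polynomial.X n 0 1 := by
    rw [← treeWeight_const _ n 0, ← sum_avoiders_eq_treeWeight _ isOrderRel_straddle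
      twoOrOneAbove_straddle n mem_avoiders_straddle, desPoly]
    simp only [Finset.prod_const, des]
  have h2 : desPoly n {[2, 4, 1, 3], [3, 1, 4, 2]} = sepSum 1 Polynomial.X n := by
    rw [desPoly, sepSum]
    refine Finset.sum_congr ?_ fun π _ => ?_
    · ext π
      simp [mem_avoiders_separable]
    · rw [weight, one_pow, one_mul]
  rw [h1, h2, ← coeff_one_add_sepSeries, map_add, PowerSeries.coeff_one, sepSeries,
    PowerSeries.coeff_mk]
  split_ifs with hn
  · rw [sepSum_of_le_one _ _ (by omega), add_zero]
  · rw [zero_add]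

end PatternWilf

theorem theorem5 :
    PatternWilf.DesNumberEquiv {[2, 4, 1, 3], [3, 1, 4, 2]} {[2, 4, 1, 3], [4, 2, 1, 3]} ∧
    PatternWilf.DesSetEquiv {[2, 4, 1, 3], [4, 2, 1, 3]} {[2, 3, 1, 4], [3, 2, 1, 4]} ∧
    PatternWilf.DesSetEquiv {[2, 3, 1, 4], [3, 2, 1, 4]} {[3, 4, 1, 2], [4, 3, 1, 2]} :=
  ⟨PatternWilf.desNumberEquiv_separable_straddle, PatternWilf.desSetEquiv_straddle_between,
    PatternWilf.desSetEquiv_between_above⟩
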